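/- Let \(S\) be the period doubling substitution \(S(0)=01\), \(S(1)=00\) on the alphabet \(\{0,1\}\), let \(u=01000101\ldots\) be the one-sided sequence having every \(S^k(0)\), \(k\ge 0\), as a prefix, and let \(\Omega_{\mathrm{pd}}\) be the set of all two-sided sequences \(\omega\in\{0,1\}^{\mathbb Z}\) all of whose finite subwords occur in \(u\). For \(\lambda\in\mathbb R\) and \(\omega\in\Omega_{\mathrm{pd}}\), let \(H=H_{\lambda,\omega}\) be the bounded self-adjoint operator on \(\ell^2(\mathbb Z)\) given by \[ (H\psi)(n)=\psi(n-1)+\psi(n+1)+\lambda\,\omega_n\,\psi(n). \] Let \(\delta_m\), \(m\in\mathbb Z\), be the canonical basis of \(\ell^2(\mathbb Z)\). For \(T>0\) and \(p>0\) put \[ a(n,T)=\frac1T\int_0^\infty e^{-2t/T}\,\bigl|\bigl(e^{-itH}\delta_1\bigr)(n)\bigr|^2\,dt,\qquad \langle |X|^p\rangle(T)=\sum_{n\in\mathbb Z}|n|^p\,a(n,T),\qquad \beta^-(p)=\liminf_{T\to+\infty}\frac{\log\,\langle |X|^p\rangle(T)}{\log T}. \] Then for every \(\lambda\in\mathbb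 R\), every \(\omega\in\Omega_{\mathrm{pd}}\) and every \(p>0\), \[ \beta^-(p)\ \ge\ \frac{p-5}{2}. \] -/

import Mathlib

open scoped ENNReal

namespace PeriodDoubling

/-! ### The period doubling subshift -/

/-- The period doubling substitution on letters, `0 ↦ 01`, `1 ↦ 00`. -/
def substLetter (a : Fin 2) : List (Fin 2) :=
  if a = 0 then [0, 1] else [0, 0]

/-- The substitution extended to finite words by concatenation. -/
def subst (w : List (Fin 2)) : List (Fin 2) :=
  w.flatMap substLetter

/-- The word `S^k(0)`. -/
def word (k : ℕ) : List (Fin 2) :=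
  subst^[k] [0]

/-- The one-sided fixed point `u = 01000101…` of the substitution, indexed from `0`. The word
`S^n(0)` has length `2 ^ n > n` and is a prefix of all later ones (see `getElem?_word`), so its
letter at position `n` is the letter of `u` at position `n`, and the default value is never
used. -/
def fixedPoint (n : ℕ) : Fin 2 :=
  (word n).getD n 0

theorem length_subst (w : List (Fin 2)) : (subst w).length = 2 * w.length := by
  induction w with
  | nil => rfl
  | cons a w ih =>
    have h : (substLetter a).length = 2 := by unfold substLetter; split <;> rfl
    simp only [subst, List.flatMap_cons, List.length_append, List.length_cons] at ih ⊢
    omega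

theorem word_succ (k : ℕ) : word (k + 1) = subst (word k) :=
  Function.iterate_succ_apply' subst k [0]

theorem length_word (k : ℕ) : (word k).length = 2 ^ k := by
  induction k with
  | zero => rfl
  | succ k ih => rw [word_succ, length_subst, ih, pow_succ, mul_comm]

theorem word_prefix_succ (k : ℕ) : word k <+: word (k + 1) := by
  induction k with
  | zero => exact ⟨[1], rfl⟩
  | succ k ih =>
    obtain ⟨t, ht⟩ := ih
    refine ⟨subst t, ?_⟩
    calc word (k + 1) ++ subst t = subst (word k) ++ subst t := by rw [word_succ k]
      _ = subst (word k ++ t) := by simp [subst]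
      _ = word (k + 1 + 1) := by rw [ht, ← word_succ]

theorem word_prefix {k l : ℕ} (h : k ≤ l) : word k <+: word l := by
  induction l, h using Nat.le_induction with
  | base => exact List.prefix_refl _
  | succ l _ ih => exact ih.trans (word_prefix_succ l)

/-- Each word `S^k(0)` is a prefix of the sequence `u`. -/
theorem getElem?_word {k i : ℕ} (h : i < 2 ^ k) : (word k)[i]? = some (fixedPoint i) := by
  have hi : i < (word i).length := by rw [length_word]; exact Nat.lt_two_pow_self
  have hk : i < (word k).length := by rwa [length_word]
  have key : (word k)[i]? = (word i)[i]? := by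
    rcases le_total k i with hki | hik
    · obtain ⟨t, ht⟩ := word_prefix hki
      rw [← ht, List.getElem?_append_left hk]
    · obtain ⟨t, ht⟩ := word_prefix hik
      rw [← ht, List.getElem?_append_left hi]
  rw [key, fixedPoint, List.getD_eq_getElem _ _ hi, List.getElem?_eq_getElem hi]

/-- The period doubling subshift: all two-sided sequences over `{0, 1}` every finite subword
`ω_m … ω_{m+l-1}` of which occurs in the one-sided sequence `u`. -/
def subshift : Set (ℤ → Fin 2) :=
  {ω | ∀ (m : ℤ) (l : ℕ), ∃ j : ℕ, ∀ i < l, ω (m + i) = fixedPoint (j + i)}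

end PeriodDoubling

namespace QuantumDynamics

/-! ### Discrete Schrödinger operators on the line -/

/-- The Hilbert space `ℓ²(ℤ)` with complex coefficients. -/
abbrev Hilb : Type := lp (fun _ : ℤ => ℂ) 2

/-- Translation on `ℓ²(ℤ)`: `(translation k ψ)(n) = ψ(n + k)`. -/
noncomputable def translation (k : ℤ) : Hilb →L[ℂ] Hilb :=
  have hp : 0 < (2 : ℝ≥0∞).toReal := by norm_num
  LinearMap.mkContinuous
    { toFun := fun ψ => ⟨fun n => ψ (n + k), (memℓp_gen_iff hp).2
        (((memℓp_gen_iff hp).1 (lp.memℓp ψ)).comp_injective (add_left_injective k))⟩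
      map_add' := fun _ _ => by ext; rfl
      map_smul' := fun _ _ => by ext; rfl }
    1
    (fun ψ => by
      rw [one_mul, lp.norm_eq_tsum_rpow hp, lp.norm_eq_tsum_rpow hp]
      exact le_of_eq (congrArg (fun x : ℝ => x ^ (1 / (2 : ℝ≥0∞).toReal))
        ((Equiv.addRight k).tsum_eq (fun n => ‖ψ n‖ ^ (2 : ℝ≥0∞).toReal))))

/-- Multiplication by a bounded real potential `V` on `ℓ²(ℤ)`. -/
noncomputable def multiplication (V : lp (fun _ : ℤ => ℝ) ∞) : Hilb →L[ℂ] Hilb :=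
  lp.mapCLM 2 (fun n => ((V n : ℝ) : ℂ) • ContinuousLinearMap.id ℂ ℂ) (norm_nonneg V)
    (fun n => by
      simpa [norm_smul] using lp.norm_apply_le_norm ENNReal.top_ne_zero V n)

/-- The Schrödinger operator `(Hψ)(n) = ψ(n - 1) + ψ(n + 1) + V(n) ψ(n)` on `ℓ²(ℤ)`. -/
noncomputable def schrodinger (V : lp (fun _ : ℤ => ℝ) ∞) : Hilb →L[ℂ] Hilb :=
  translation (-1) + translation 1 + multiplication V

theorem schrodinger_apply (V : lp (fun _ : ℤ => ℝ) ∞) (ψ : Hilb) (n : ℤ) :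
    schrodinger V ψ n = ψ (n - 1) + ψ (n + 1) + (V n : ℂ) * ψ n := by
  rfl

/-- The canonical basis vector `δ_m` of `ℓ²(ℤ)`. -/
noncomputable def delta (m : ℤ) : Hilb :=
  lp.single 2 m (1 : ℂ)

/-! ### Dynamics -/

/-- The time evolution `ψ(t) = exp(-itH) ψ`. -/
noncomputable def evolution (H : Hilb →L[ℂ] Hilb) (t : ℝ) (ψ : Hilb) : Hilb :=
  NormedSpace.exp ((-(t : ℂ) * Complex.I) • H) ψ

/-- The time-averaged probability of being at site `n`,
`a(n, T) = (1 / T) ∫_0^∞ e^{-2t/T} |ψ(t, n)|² dt` (for `T > 0`). -/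
noncomputable def avgProb (H : Hilb →L[ℂ] Hilb) (ψ : Hilb) (n : ℤ) (T : ℝ) : ℝ≥0∞ :=
  ENNReal.ofReal (1 / T) *
    ∫⁻ t in Set.Ioi (0 : ℝ), ENNReal.ofReal (Real.exp (-2 * t / T) * ‖evolution H t ψ n‖ ^ 2)

/-- The time-averaged moment of order `p` of the position operator,
`⟨|X|_ψ^p⟩(T) = ∑_n |n|^p a(n, T)`. -/
noncomputable def avgMoment (H : Hilb →L[ℂ] Hilb) (ψ : Hilb) (p T : ℝ) : ℝ≥0∞ :=
  ∑' n : ℤ, ENNReal.ofReal (|(n : ℝ)| ^ p) * avgProb H ψ n T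

/-- The lower growth exponent
`β⁻(p) = liminf_{T → ∞} log ⟨|X|_ψ^p⟩(T) / log T`, as an extended real number. -/
noncomputable def betaMinus (H : Hilb →L[ℂ] Hilb) (ψ : Hilb) (p : ℝ) : EReal :=
  Filter.liminf (fun T : ℝ => ENNReal.log (avgMoment H ψ p T) / (Real.log T : EReal))
    Filter.atTop

end QuantumDynamics

namespace PeriodDoubling

/-- The potential `V_{λ,ω}(n) = λ ω_n`. -/
noncomputable def potential (lam : ℝ) (ω : ℤ → Fin 2) : lp (fun _ : ℤ => ℝ) ∞ :=
  ⟨fun n => lam * ((ω n : ℕ) : ℝ), memℓp_infty ⟨|lam|, by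
    rintro _ ⟨n, rfl⟩
    have h : ((ω n : ℕ) : ℝ) ≤ 1 := by exact_mod_cast Nat.le_of_lt_succ (ω n).isLt
    simpa [abs_mul] using mul_le_mul_of_nonneg_left h (abs_nonneg lam)⟩⟩

/-- The period doubling Hamiltonian with coupling constant `lam` and phase `ω`. -/
noncomputable def hamiltonian (lam : ℝ) (ω : ℤ → Fin 2) :
    QuantumDynamics.Hilb →L[ℂ] QuantumDynamics.Hilb :=
  QuantumDynamics.schrodinger (potential lam ω)

end PeriodDoubling

/-!
The Laplace transform of `exp(-itH) δ_m` at rate `2 / T` solves `(H - 2i/T) u = -i δ_m`, and by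
Cauchy–Schwarz `|u(n)|² / T²` is at most a multiple of `a(n, T)`. The letters of the period
doubling fixed point at even positions are `0`, so `V` vanishes on a coset of `2ℤ`. There the
recursion `u(n - 1) + u(n + 1) = (2i/T - V(n)) u(n)` has coefficient `O(1 / T)`, hence products of
`O(√T)` transfer matrices have norm `O(√T)`. Since the source at `m` forces `u` to be of order `1`
near `m`, in one of the two directions `|u(n)| + |u(n ± 1)|` is at least of order `1 / √T` at `√T`
sites at distance of order `√T`. Their contribution to the moment is at least of order
`√T · T^{p/2} · T^{-1} · T^{-2} = T^{(p-5)/2}`.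
-/

namespace QuantumDynamics

open MeasureTheory Set Filter Topology

theorem inner_translation (k : ℤ) (x y : Hilb) :
    inner ℂ (translation k x) y = inner ℂ x (translation (-k) y) := by
  rw [lp.inner_eq_tsum, lp.inner_eq_tsum,
    ← (Equiv.addRight k).tsum_eq (fun n => inner ℂ (x n) (translation (-k) y n))]
  refine tsum_congr fun n => ?_
  change inner ℂ (x (n + k)) (y n) = inner ℂ (x (n + k)) (y (n + k + -k))
  rw [add_neg_cancel_right]

theorem inner_multiplication (V : lp (fun _ : ℤ => ℝ) ∞) (x y : Hilb) :
    inner ℂ (multiplication V x) y = inner ℂ x (multiplication V y) := by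
  rw [lp.inner_eq_tsum, lp.inner_eq_tsum]
  refine tsum_congr fun n => ?_
  change inner ℂ ((V n : ℂ) * x n) (y n) = inner ℂ (x n) ((V n : ℂ) * y n)
  simp only [RCLike.inner_apply, map_mul, Complex.conj_ofReal]
  ring

theorem isSelfAdjoint_schrodinger (V : lp (fun _ : ℤ => ℝ) ∞) :
    IsSelfAdjoint (schrodinger V) := by
  refine ContinuousLinearMap.isSelfAdjoint_iff_isSymmetric.2 fun x y => ?_
  change inner ℂ (schrodinger V x) y = inner ℂ x (schrodinger V y)
  simp only [schrodinger, add_apply, inner_add_left, inner_add_right, inner_translation,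
    inner_multiplication, neg_neg]
  ring

section Evolution

variable (H : Hilb →L[ℂ] Hilb) (ψ : Hilb)

theorem evolution_zero : evolution H 0 ψ = ψ := by
  simp [evolution]

theorem hasDerivAt_evolution (t : ℝ) :
    HasDerivAt (fun t : ℝ => evolution H t ψ) (-Complex.I • H (evolution H t ψ)) t := by
  have hexp : HasDerivAt (fun s : ℂ => NormedSpace.exp (s • H))
      (H * NormedSpace.exp ((-(t : ℂ) * Complex.I) • H)) (-(t : ℂ) * Complex.I) :=
    hasDerivAt_exp_smul_const' H _
  have htime : HasDerivAt (fun t : ℝ => -(t : ℂ) * Complex.I) (-Complex.I) t := by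
    simpa using (Complex.ofRealCLM.hasDerivAt (x := t)).neg.mul_const Complex.I
  exact ((ContinuousLinearMap.apply ℂ Hilb ψ).restrictScalars ℝ).hasFDerivAt.comp_hasDerivAt t
    (hexp.scomp t htime)

theorem continuous_evolution : Continuous (fun t : ℝ => evolution H t ψ) :=
  continuous_iff_continuousAt.2 fun t => (hasDerivAt_evolution H ψ t).continuousAt

variable {H}

theorem norm_evolution (hH : IsSelfAdjoint H) (t : ℝ) : ‖evolution H t ψ‖ = ‖ψ‖ := by
  have ht : IsSelfAdjoint (-(t : ℂ)) := by simp [isSelfAdjoint_iff]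
  have hU := (selfAdjoint.expUnitary ⟨(-(t : ℂ)) • H, IsSelfAdjoint.smul ht hH⟩).2
  rw [selfAdjoint.expUnitary_coe, smul_smul, mul_comm] at hU
  exact ContinuousLinearMap.norm_map_of_mem_unitary hU ψ

end Evolution

section Laplace

/-- The Laplace transform `∫_0^∞ e^{-εt} ψ(t) dt` of the time evolution. It equals
`-i (H - iε)⁻¹ ψ`, so it turns the dynamics into a resolvent equation. -/
noncomputable def laplaceEvolution (H : Hilb →L[ℂ] Hilb) (ε : ℝ) (ψ : Hilb) : Hilb :=
  ∫ t in Ioi (0 : ℝ), Real.exp (-ε * t) • evolution H t ψ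

variable {H : Hilb →L[ℂ] Hilb} (hH : IsSelfAdjoint H) {ε : ℝ} (hε : 0 < ε) (ψ : Hilb)
include hH hε

theorem integrableOn_exp_smul_evolution :
    IntegrableOn (fun t : ℝ => Real.exp (-ε * t) • evolution H t ψ) (Ioi 0) :=
  Integrable.smul_bdd (exp_neg_integrableOn_Ioi 0 hε) ‖ψ‖
    (continuous_evolution H ψ).aestronglyMeasurable
    (ae_of_all _ fun t => (norm_evolution ψ hH t).le)

theorem laplaceEvolution_apply (n : ℤ) :
    laplaceEvolution H ε ψ n = ∫ t in Ioi (0 : ℝ), Real.exp (-ε * t) • evolution H t ψ n :=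
  ((lp.evalCLM ℂ (fun _ : ℤ => ℂ) 2 n).integral_comp_comm
    (integrableOn_exp_smul_evolution hH hε ψ)).symm

theorem tendsto_exp_smul_evolution :
    Tendsto (fun t : ℝ => Real.exp (-ε * t) • evolution H t ψ) atTop (𝓝 0) := by
  have hexp : Tendsto (fun t : ℝ => Real.exp (-ε * t)) atTop (𝓝 0) :=
    Real.tendsto_exp_atBot.comp (tendsto_id.const_mul_atTop_of_neg (neg_lt_zero.2 hε))
  exact hexp.zero_smul_isBoundedUnder_le
    (isBoundedUnder_of ⟨‖ψ‖, fun t => (norm_evolution ψ hH t).le⟩)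

theorem apply_laplaceEvolution :
    H (laplaceEvolution H ε ψ) = (Complex.I * ε) • laplaceEvolution H ε ψ - Complex.I • ψ := by
  let A : Hilb →L[ℂ] Hilb := (-ε : ℂ) • ContinuousLinearMap.id ℂ Hilb - Complex.I • H
  have hA : ∀ x, A x = (-ε : ℂ) • x - Complex.I • H x := fun _ => rfl
  have hint := integrableOn_exp_smul_evolution hH hε ψ
  have hderiv : ∀ t ∈ Ici (0 : ℝ), HasDerivAt (fun t : ℝ => Real.exp (-ε * t) • evolution H t ψ)
      (A (Real.exp (-ε * t) • evolution H t ψ)) t := fun t _ => by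
    have hexp : HasDerivAt (fun t : ℝ => Real.exp (-ε * t)) (Real.exp (-ε * t) * -ε) t := by
      simpa using ((hasDerivAt_id t).const_mul (-ε)).exp
    refine (hexp.smul (hasDerivAt_evolution H ψ t)).congr_deriv ?_
    rw [A.map_smul_of_tower, hA]
    simp only [RCLike.real_smul_eq_coe_smul (K := ℂ), Complex.coe_algebraMap, RCLike.ofReal_mul,
      RCLike.ofReal_neg]
    module
  have hftc := integral_Ioi_of_hasDerivAt_of_tendsto' hderiv
    (A.integrable_comp hint) (tendsto_exp_smul_evolution hH hε ψ)
  rw [A.integral_comp_comm hint, ← laplaceEvolution, hA, mul_zero, Real.exp_zero, one_smul,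
    evolution_zero, zero_sub] at hftc
  refine smul_right_injective Hilb Complex.I_ne_zero ?_
  simp only [smul_sub, smul_smul, ← mul_assoc, Complex.I_mul_I, neg_one_smul, neg_one_mul]
  linear_combination (norm := module) -hftc

end Laplace

theorem enorm_integral_smul_sq_le {α E : Type*} [MeasurableSpace α] {μ : Measure α}
    [NormedAddCommGroup E] [NormedSpace ℝ E] {w : α → ℝ} {f : α → E}
    (hw : AEMeasurable w μ) (hf : AEStronglyMeasurable f μ) :
    ‖∫ a, w a • f a ∂μ‖ₑ ^ 2 ≤ (∫⁻ a, ‖w a‖ₑ ∂μ) * ∫⁻ a, ‖w a‖ₑ * ‖f a‖ₑ ^ 2 ∂μ := by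
  calc ‖∫ a, w a • f a ∂μ‖ₑ ^ 2
      ≤ (∫⁻ a, ‖w a • f a‖ₑ ∂μ) ^ 2 := by gcongr; exact enorm_integral_le_lintegral_enorm _
    _ = (∫⁻ a, ‖w a‖ₑ ^ (1 / 2 : ℝ) * (‖w a‖ₑ * ‖f a‖ₑ ^ 2) ^ (1 / 2 : ℝ) ∂μ) ^ 2 := by
        congr 1
        refine lintegral_congr fun a => ?_
        rw [enorm_smul, ENNReal.mul_rpow_of_nonneg _ _ (by norm_num), ← mul_assoc,
          ← ENNReal.rpow_add_of_nonneg _ _ (by norm_num) (by norm_num), ← ENNReal.rpow_natCast,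
          ← ENNReal.rpow_mul]
        norm_num
    _ ≤ ((∫⁻ a, ‖w a‖ₑ ∂μ) ^ (1 / 2 : ℝ) *
          (∫⁻ a, ‖w a‖ₑ * ‖f a‖ₑ ^ 2 ∂μ) ^ (1 / 2 : ℝ)) ^ 2 := by
        gcongr
        exact ENNReal.lintegral_mul_norm_pow_le hw.enorm (hw.enorm.mul (hf.enorm.pow_const 2))
          (by norm_num) (by norm_num) (by norm_num)
    _ = (∫⁻ a, ‖w a‖ₑ ∂μ) * ∫⁻ a, ‖w a‖ₑ * ‖f a‖ₑ ^ 2 ∂μ := by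
        rw [← ENNReal.mul_rpow_of_nonneg _ _ (by norm_num), ← ENNReal.rpow_natCast,
          ← ENNReal.rpow_mul]
        norm_num

theorem lintegral_enorm_exp_neg_mul {ε : ℝ} (hε : 0 < ε) :
    ∫⁻ t in Ioi (0 : ℝ), ‖Real.exp (-ε * t)‖ₑ = ENNReal.ofReal (1 / ε) := by
  rw [← ofReal_integral_norm_eq_lintegral_enorm (exp_neg_integrableOn_Ioi 0 hε)]
  simp_rw [Real.norm_of_nonneg (Real.exp_pos _).le]
  rw [integral_exp_mul_Ioi (neg_lt_zero.2 hε)]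
  simp [neg_div_neg_eq]

theorem avgProb_eq_lintegral_enorm (H : Hilb →L[ℂ] Hilb) (ψ : Hilb) (n : ℤ) (T : ℝ) :
    avgProb H ψ n T = ENNReal.ofReal (1 / T) *
      ∫⁻ t in Ioi (0 : ℝ), ‖Real.exp (-(2 / T) * t)‖ₑ * ‖evolution H t ψ n‖ₑ ^ 2 := by
  rw [avgProb]
  congr 1
  refine lintegral_congr fun t => ?_
  rw [ENNReal.ofReal_mul (Real.exp_pos _).le, ENNReal.ofReal_pow (norm_nonneg _), ofReal_norm,
    Real.enorm_of_nonneg (Real.exp_pos _).le, neg_div', div_mul_eq_mul_div]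

theorem ofReal_sq_norm_laplaceEvolution_le_avgProb {H : Hilb →L[ℂ] Hilb} (hH : IsSelfAdjoint H)
    (ψ : Hilb) (n : ℤ) {T : ℝ} (hT : 0 < T) :
    ENNReal.ofReal (2 / T ^ 2 * ‖laplaceEvolution H (2 / T) ψ n‖ ^ 2) ≤ avgProb H ψ n T := by
  have hε : 0 < 2 / T := by positivity
  have hcs := enorm_integral_smul_sq_le (μ := volume.restrict (Ioi 0))
    (w := fun t => Real.exp (-(2 / T) * t)) (f := fun t => evolution H t ψ n)
    (by fun_prop)
    ((lp.evalCLM ℂ (fun _ : ℤ => ℂ) 2 n).continuous.comp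
      (continuous_evolution H ψ)).aestronglyMeasurable
  rw [← laplaceEvolution_apply hH hε, lintegral_enorm_exp_neg_mul hε] at hcs
  calc ENNReal.ofReal (2 / T ^ 2 * ‖laplaceEvolution H (2 / T) ψ n‖ ^ 2)
      = ENNReal.ofReal (2 / T ^ 2) * ‖laplaceEvolution H (2 / T) ψ n‖ₑ ^ 2 := by
        rw [ENNReal.ofReal_mul (by positivity), ENNReal.ofReal_pow (norm_nonneg _), ofReal_norm]
    _ ≤ ENNReal.ofReal (2 / T ^ 2) * (ENNReal.ofReal (1 / (2 / T)) *
          ∫⁻ t in Ioi (0 : ℝ), ‖Real.exp (-(2 / T) * t)‖ₑ * ‖evolution H t ψ n‖ₑ ^ 2) := by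
        gcongr
    _ = avgProb H ψ n T := by
        rw [avgProb_eq_lintegral_enorm, ← mul_assoc, ← ENNReal.ofReal_mul (by positivity)]
        congr 2
        field_simp

theorem add_le_one_add_pow_mul_add {q : ℝ} (hq : 0 ≤ q) {b : ℕ → ℝ} (hb : ∀ k, 0 ≤ b k)
    (hrec : ∀ k, b k ≤ q * b (k + 1) + b (k + 2)) (k : ℕ) :
    b 0 + b 1 ≤ (1 + q) ^ k * (b k + b (k + 1)) := by
  induction k with
  | zero => simp
  | succ k ih =>
    have hstep : b k + b (k + 1) ≤ (1 + q) * (b (k + 1) + b (k + 2)) := by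
      linarith [hrec k, mul_nonneg hq (hb (k + 2))]
    calc b 0 + b 1 ≤ (1 + q) ^ k * (b k + b (k + 1)) := ih
      _ ≤ (1 + q) ^ k * ((1 + q) * (b (k + 1) + b (k + 2))) := by gcongr
      _ = (1 + q) ^ (k + 1) * (b (k + 1) + b (k + 1 + 1)) := by ring

/-- The weight equal to `1` on the coset `{n | n + σ even}` and to `R` off it. Measured with it,
the solutions of a recursion whose coefficient is `O(R⁻²)` on the coset and `O(1)` off it grow by
a factor of only `1 + O(R⁻¹)` per step. -/
noncomputable def parityWeight (R : ℝ) (σ n : ℤ) : ℝ :=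
  if Even (n + σ) then 1 else R

section Propagation

variable {𝕜 : Type*} [NormedField 𝕜] {u W : ℤ → 𝕜} {K R : ℝ} {σ m : ℤ}

theorem one_le_parityWeight (hR : 1 ≤ R) (σ n : ℤ) : 1 ≤ parityWeight R σ n := by
  unfold parityWeight; split_ifs <;> linarith

theorem parityWeight_le (hR : 1 ≤ R) (σ n : ℤ) : parityWeight R σ n ≤ R := by
  unfold parityWeight; split_ifs <;> linarith

theorem even_add_unit_add_iff (n σ : ℤ) (s : ℤˣ) : Even (n + s + σ) ↔ ¬ Even (n + σ) := by
  rcases Int.units_eq_one_or s with rfl | rfl <;> simp only [Int.even_iff, Units.val_one,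
    Units.val_neg] <;> omega

theorem parityWeight_sub_unit (R : ℝ) (σ n : ℤ) (s : ℤˣ) :
    parityWeight R σ (n - s) = parityWeight R σ (n + s) := by
  rw [sub_eq_add_neg, ← Units.val_neg]
  simp only [parityWeight, even_add_unit_add_iff]

theorem parityWeight_add_unit_mul_norm_le (hR : 0 < R) (hW : ∀ n, ‖W n‖ ≤ K)
    (hWσ : ∀ n, Even (n + σ) → ‖W n‖ ≤ K / R ^ 2) (n : ℤ) (s : ℤˣ) :
    parityWeight R σ (n + s) * ‖W n‖ ≤ K / R * parityWeight R σ n := by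
  by_cases h : Even (n + σ)
  · simp only [parityWeight, even_add_unit_add_iff, h, not_true, if_true, if_false, mul_one]
    calc R * ‖W n‖ ≤ R * (K / R ^ 2) := by gcongr; exact hWσ n h
      _ = K / R := by field_simp
  · simp only [parityWeight, even_add_unit_add_iff, h, not_false_eq_true, if_true, if_false,
      one_mul]
    rw [div_mul_cancel₀ K hR.ne']
    exact hW n

theorem parityWeight_mul_norm_sub_unit_le (hR : 1 ≤ R) (hW : ∀ n, ‖W n‖ ≤ K)
    (hWσ : ∀ n, Even (n + σ) → ‖W n‖ ≤ K / R ^ 2) {n : ℤ}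
    (hu : u (n - 1) + u (n + 1) = W n * u n) (s : ℤˣ) :
    parityWeight R σ (n - s) * ‖u (n - s)‖ ≤
      K / R * (parityWeight R σ n * ‖u n‖) + parityWeight R σ (n + s) * ‖u (n + s)‖ := by
  have hs : u (n - s) = W n * u n - u (n + s) := by
    rcases Int.units_eq_one_or s with rfl | rfl
    · simpa using eq_sub_of_add_eq hu
    · simpa [← sub_eq_add_neg] using eq_sub_of_add_eq' hu
  have hw : 0 ≤ parityWeight R σ (n + s) := zero_le_one.trans (one_le_parityWeight hR _ _)
  calc parityWeight R σ (n - s) * ‖u (n - s)‖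
      ≤ parityWeight R σ (n + s) * (‖W n‖ * ‖u n‖ + ‖u (n + s)‖) := by
        rw [parityWeight_sub_unit, hs, ← norm_mul]
        gcongr
        exact norm_sub_le _ _
    _ = parityWeight R σ (n + s) * ‖W n‖ * ‖u n‖ + parityWeight R σ (n + s) * ‖u (n + s)‖ := by
        ring
    _ ≤ K / R * parityWeight R σ n * ‖u n‖ + parityWeight R σ (n + s) * ‖u (n + s)‖ := by
        gcongr ?_ * _ + _
        exact parityWeight_add_unit_mul_norm_le (by linarith) hW hWσ n s
    _ = _ := by ring

theorem exists_unit_le_norm_add_norm (hK : 1 ≤ K) (hWm : ‖W m‖ ≤ K)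
    (hsource : 1 ≤ ‖u (m - 1) + u (m + 1) - W m * u m‖) :
    ∃ s : ℤˣ, 1 / (2 * K) ≤ ‖u m‖ + ‖u (m + s)‖ := by
  by_contra! h
  have hright : ‖u m‖ + ‖u (m + 1)‖ < 1 / (2 * K) := by simpa using h 1
  have hleft : ‖u m‖ + ‖u (m - 1)‖ < 1 / (2 * K) := by simpa [sub_eq_add_neg] using h (-1)
  refine hsource.not_gt ?_
  calc ‖u (m - 1) + u (m + 1) - W m * u m‖
      ≤ ‖u (m - 1)‖ + ‖u (m + 1)‖ + ‖W m‖ * ‖u m‖ := by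
        rw [← norm_mul]
        exact (norm_sub_le _ _).trans (by gcongr; exact norm_add_le _ _)
    _ ≤ K * ‖u (m - 1)‖ + K * ‖u (m + 1)‖ + K * ‖u m‖ := by
        gcongr <;> exact le_mul_of_one_le_left (norm_nonneg _) hK
    _ ≤ K * ((‖u m‖ + ‖u (m - 1)‖) + (‖u m‖ + ‖u (m + 1)‖)) := by
        linarith [mul_nonneg (zero_le_one.trans hK) (norm_nonneg (u m))]
    _ < K * (1 / (2 * K) + 1 / (2 * K)) := by gcongr
    _ = 1 := by field_simp; norm_num

theorem exists_unit_forall_le_norm_add_norm (hK : 1 ≤ K) (hR : 1 ≤ R) (hW : ∀ n, ‖W n‖ ≤ K)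
    (hWσ : ∀ n, Even (n + σ) → ‖W n‖ ≤ K / R ^ 2)
    (hu : ∀ n ≠ m, u (n - 1) + u (n + 1) = W n * u n)
    (hsource : 1 ≤ ‖u (m - 1) + u (m + 1) - W m * u m‖) :
    ∃ s : ℤˣ, ∀ k : ℕ, 1 / (2 * K) ≤
      Real.exp (k * (K / R)) * (R * (‖u (m + s * k)‖ + ‖u (m + s * (k + 1 : ℕ))‖)) := by
  obtain ⟨s, hs⟩ := exists_unit_le_norm_add_norm hK (hW m) hsource
  refine ⟨s, fun k => ?_⟩
  have hw1 := one_le_parityWeight hR σ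
  set b : ℕ → ℝ := fun k => parityWeight R σ (m + s * k) * ‖u (m + s * k)‖ with hb
  have hb0 : ∀ k, 0 ≤ b k := fun k => mul_nonneg (zero_le_one.trans (hw1 _)) (norm_nonneg _)
  have hbR : ∀ k, b k ≤ R * ‖u (m + s * k)‖ := fun k => by
    simp only [hb]; gcongr; exact parityWeight_le hR _ _
  have hrec : ∀ k, b k ≤ K / R * b (k + 1) + b (k + 2) := fun k => by
    have hne : m + s * ((k : ℤ) + 1) ≠ m := by
      simpa using (by omega : (k : ℤ) + 1 ≠ 0)
    have h := parityWeight_mul_norm_sub_unit_le hR hW hWσ (hu _ hne) s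
    simp only [hb]
    push_cast
    convert h using 3 <;> ring_nf
  calc 1 / (2 * K) ≤ ‖u m‖ + ‖u (m + s)‖ := hs
    _ ≤ b 0 + b 1 := by
        simp only [hb, Nat.cast_zero, mul_zero, add_zero, Nat.cast_one, mul_one]
        gcongr <;> exact le_mul_of_one_le_left (norm_nonneg _) (hw1 _)
    _ ≤ (1 + K / R) ^ k * (b k + b (k + 1)) := add_le_one_add_pow_mul_add (by positivity) hb0 hrec k
    _ ≤ Real.exp (K / R) ^ k *
          (R * ‖u (m + s * k)‖ + R * ‖u (m + s * (k + 1 : ℕ))‖) := by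
        gcongr
        · exact add_nonneg (hb0 _) (hb0 _)
        · rw [add_comm]; exact Real.add_one_le_exp _
        · exact hbR k
        · exact hbR (k + 1)
    _ = _ := by rw [← Real.exp_nat_mul, mul_add R]

end Propagation

theorem sum_add_succ_le_two_mul_tsum {α : Type*} (F : α → ℝ≥0∞) {g : ℕ → α} (hg : g.Injective)
    (s : Finset ℕ) : ∑ k ∈ s, (F (g k) + F (g (k + 1))) ≤ 2 * ∑' a, F a := by
  rw [Finset.sum_add_distrib, two_mul]
  gcongr
  · exact (ENNReal.sum_le_tsum s).trans (ENNReal.tsum_comp_le_tsum_of_injective hg F)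
  · exact (ENNReal.sum_le_tsum s).trans
      (ENNReal.tsum_comp_le_tsum_of_injective (hg.comp (add_left_injective 1)) F)

theorem coe_le_liminf_log_div_log {f : ℝ → ℝ≥0∞} {c s : ℝ} (hc : 0 < c)
    (hf : ∀ᶠ T : ℝ in atTop, ENNReal.ofReal (c * T ^ s) ≤ f T) :
    (s : EReal) ≤ liminf (fun T : ℝ => ENNReal.log (f T) / (Real.log T : EReal)) atTop := by
  refine EReal.ge_of_forall_gt_iff_ge.1 fun r hr => ?_
  have hrs : 0 < s - r := sub_pos.2 (by exact_mod_cast hr)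
  refine le_liminf_of_le (by isBoundedDefault) ?_
  filter_upwards [hf, eventually_gt_atTop 1,
    (tendsto_rpow_atTop hrs).eventually_ge_atTop c⁻¹] with T hT hT1 hTc
  have hT0 : 0 < T := by linarith
  have hle : T ^ r ≤ c * T ^ s := by
    calc T ^ r = c * (c⁻¹ * T ^ r) := by field_simp
      _ ≤ c * (T ^ (s - r) * T ^ r) := by gcongr
      _ = c * T ^ s := by rw [← Real.rpow_add hT0, sub_add_cancel]
  rw [EReal.le_div_iff_mul_le (by exact_mod_cast Real.log_pos hT1) (EReal.coe_ne_top _)]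
  calc (r : EReal) * (Real.log T : EReal) = ENNReal.log (ENNReal.ofReal (T ^ r)) := by
        rw [ENNReal.log_ofReal_of_pos (Real.rpow_pos_of_pos hT0 r), Real.log_rpow hT0,
          EReal.coe_mul]
    _ ≤ ENNReal.log (f T) := ENNReal.log_monotone ((ENNReal.ofReal_le_ofReal hle).trans hT)

end QuantumDynamics

namespace PeriodDoubling

theorem getElem?_subst_two_mul {w : List (Fin 2)} {i : ℕ} (h : i < w.length) :
    (subst w)[2 * i]? = some 0 := by
  induction w generalizing i with
  | nil => simp at h
  | cons a w ih =>
    obtain ⟨b, hb⟩ : ∃ b, substLetter a = [0, b] := by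
      unfold substLetter; split <;> exact ⟨_, rfl⟩
    have hcons : subst (a :: w) = 0 :: b :: subst w := by simp [subst, hb]
    rw [hcons]
    cases i with
    | zero => rfl
    | succ i => simpa [mul_add] using ih (by simpa using h)

theorem fixedPoint_two_mul (i : ℕ) : fixedPoint (2 * i) = 0 := by
  have hi : i < 2 ^ i := Nat.lt_two_pow_self
  have hletter : (word (i + 1))[2 * i]? = some (fixedPoint (2 * i)) :=
    getElem?_word (by rw [pow_succ]; omega)
  rw [word_succ, getElem?_subst_two_mul (by rwa [length_word])] at hletter
  exact (Option.some.inj hletter).symm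

theorem odd_of_fixedPoint_ne_zero {n : ℕ} (hn : fixedPoint n ≠ 0) : Odd n := by
  by_contra h
  obtain ⟨i, rfl⟩ := (Nat.not_odd_iff_even.1 h).exists_two_nsmul
  exact hn (fixedPoint_two_mul i)

theorem even_sub_of_ne_zero {ω : ℤ → Fin 2} (hω : ω ∈ subshift) {a b : ℤ} (ha : ω a ≠ 0)
    (hb : ω b ≠ 0) : Even (b - a) := by
  wlog hab : a ≤ b generalizing a b
  · rw [← even_neg, neg_sub]
    exact this hb ha (le_of_not_ge hab)
  obtain ⟨l, rfl⟩ := Int.le.dest hab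
  obtain ⟨j, hj⟩ := hω a (l + 1)
  have hj0 : ω a = fixedPoint j := by simpa using hj 0 (by omega)
  have hodd : Odd j := odd_of_fixedPoint_ne_zero (by rwa [← hj0])
  have hodd_add : Odd (j + l) := odd_of_fixedPoint_ne_zero (by rwa [← hj l (by omega)])
  rw [add_sub_cancel_left, Int.even_coe_nat]
  exact (Nat.odd_add.1 hodd_add).1 hodd

theorem exists_forall_even_eq_zero {ω : ℤ → Fin 2} (hω : ω ∈ subshift) :
    ∃ σ : ℤ, ∀ n, Even (n + σ) → ω n = 0 := by
  by_cases h : ∃ a, ω a ≠ 0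
  · obtain ⟨a, ha⟩ := h
    refine ⟨1 - a, fun n hn => by_contra fun hn0 => ?_⟩
    have heven := even_sub_of_ne_zero hω ha hn0
    rw [show n + (1 - a) = n - a + 1 by ring, Int.even_add_one] at hn
    exact hn heven
  · push Not at h
    exact ⟨0, fun n _ => h n⟩

theorem exists_forall_even_potential_eq_zero (lam : ℝ) {ω : ℤ → Fin 2} (hω : ω ∈ subshift) :
    ∃ σ : ℤ, ∀ n, Even (n + σ) → potential lam ω n = 0 := by
  obtain ⟨σ, hσ⟩ := exists_forall_even_eq_zero hω
  refine ⟨σ, fun n hn => ?_⟩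
  change lam * ((ω n : ℕ) : ℝ) = 0
  rw [hσ n hn, Fin.val_zero, Nat.cast_zero, mul_zero]

end PeriodDoubling

namespace QuantumDynamics

theorem delta_self (m : ℤ) : delta m m = 1 := lp.single_apply_self ..

theorem delta_of_ne {m n : ℤ} (h : n ≠ m) : delta m n = 0 := lp.single_apply_ne _ _ _ h

theorem laplaceEvolution_schrodinger_recurrence (V : lp (fun _ : ℤ => ℝ) ∞) (ψ : Hilb) {ε : ℝ}
    (hε : 0 < ε) (n : ℤ) :
    laplaceEvolution (schrodinger V) ε ψ (n - 1) + laplaceEvolution (schrodinger V) ε ψ (n + 1) =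
      (Complex.I * ε - V n) * laplaceEvolution (schrodinger V) ε ψ n - Complex.I * ψ n := by
  have h := congrArg (fun φ : Hilb => φ n)
    (apply_laplaceEvolution (isSelfAdjoint_schrodinger V) hε ψ)
  simp only [schrodinger_apply] at h
  change _ = Complex.I * ε * laplaceEvolution (schrodinger V) ε ψ n - Complex.I * ψ n at h
  linear_combination h

theorem ofReal_sq_div_sq_le_avgProb_add_avgProb {H : Hilb →L[ℂ] Hilb} (hH : IsSelfAdjoint H)
    (ψ : Hilb) (a b : ℤ) {T : ℝ} (hT : 0 < T) :
    ENNReal.ofReal (((‖laplaceEvolution H (2 / T) ψ a‖ + ‖laplaceEvolution H (2 / T) ψ b‖) / T) ^ 2)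
      ≤ avgProb H ψ a T + avgProb H ψ b T := by
  refine le_trans ?_ (add_le_add (ofReal_sq_norm_laplaceEvolution_le_avgProb hH ψ a hT)
    (ofReal_sq_norm_laplaceEvolution_le_avgProb hH ψ b hT))
  rw [← ENNReal.ofReal_add (by positivity) (by positivity), ← mul_add, div_pow,
    div_mul_eq_mul_div]
  gcongr
  exact add_sq_le

theorem ofReal_card_mul_le_avgMoment {H : Hilb →L[ℂ] Hilb} (hH : IsSelfAdjoint H) (ψ : Hilb)
    {p : ℝ} (hp : 0 ≤ p) {T : ℝ} (hT : 0 < T) {R b : ℝ} (hR : 0 ≤ R) (hb : 0 ≤ b) {g : ℕ → ℤ}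
    (hg : g.Injective) {s : Finset ℕ}
    (hfar : ∀ k ∈ s, R ≤ |(g k : ℝ)| ∧ R ≤ |(g (k + 1) : ℝ)|)
    (hlarge : ∀ k ∈ s, b ≤ ‖laplaceEvolution H (2 / T) ψ (g k)‖ +
      ‖laplaceEvolution H (2 / T) ψ (g (k + 1))‖) :
    ENNReal.ofReal (s.card * (R ^ p * (b / T) ^ 2)) ≤ 2 * avgMoment H ψ p T := by
  set F : ℤ → ℝ≥0∞ := fun n => ENNReal.ofReal (|(n : ℝ)| ^ p) * avgProb H ψ n T
  have hF : ∀ n : ℤ, R ≤ |(n : ℝ)| → ENNReal.ofReal (R ^ p) * avgProb H ψ n T ≤ F n :=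
    fun n hn => by simp only [F]; gcongr
  calc ENNReal.ofReal (s.card * (R ^ p * (b / T) ^ 2))
      = ∑ _k ∈ s, ENNReal.ofReal (R ^ p) * ENNReal.ofReal ((b / T) ^ 2) := by
        rw [ENNReal.ofReal_mul (by positivity), ENNReal.ofReal_mul (by positivity),
          ENNReal.ofReal_natCast, Finset.sum_const, nsmul_eq_mul]
    _ ≤ ∑ k ∈ s, (F (g k) + F (g (k + 1))) := by
        refine Finset.sum_le_sum fun k hk => ?_
        refine le_trans ?_ (add_le_add (hF _ (hfar k hk).1) (hF _ (hfar k hk).2))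
        rw [← mul_add]
        gcongr
        refine le_trans ?_ (ofReal_sq_div_sq_le_avgProb_add_avgProb hH ψ _ _ hT)
        gcongr
        exact hlarge k hk
    _ ≤ 2 * avgMoment H ψ p T := sum_add_succ_le_two_mul_tsum F hg s

theorem le_abs_add_unit_mul {m : ℤ} {r : ℝ} (hm : |(m : ℝ)| ≤ r) {k : ℕ} (hk : 2 * r ≤ k)
    (s : ℤˣ) : r ≤ |((m + s * k : ℤ) : ℝ)| := by
  have hs : |((s * k : ℤ) : ℝ)| = k := by
    rw [← Int.cast_abs, abs_mul, Int.isUnit_iff_abs_eq.1 s.isUnit, one_mul, Nat.abs_cast,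
      Int.cast_natCast]
  calc r ≤ |((s * k : ℤ) : ℝ)| - |(m : ℝ)| := by linarith
    _ ≤ |((m + s * k : ℤ) : ℝ)| := by
      rw [Int.cast_add, add_comm]; exact abs_sub_abs_le_abs_add _ _

theorem add_unit_mul_injective (m : ℤ) (s : ℤˣ) :
    Function.Injective fun k : ℕ => m + s * (k : ℤ) :=
  (add_right_injective m).comp ((mul_right_injective₀ s.ne_zero).comp Nat.cast_injective)

theorem sqrt_mul_sqrt_rpow_mul_div_sq {T : ℝ} (hT : 0 < T) (p c : ℝ) :
    √T * (√T ^ p * (c / √T / T) ^ 2) = c ^ 2 * T ^ ((p - 5) / 2) := by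
  have hR : 0 < √T := Real.sqrt_pos.2 hT
  calc √T * (√T ^ p * (c / √T / T) ^ 2) = √T * (√T ^ p * (c / √T / √T ^ 2) ^ 2) := by
        rw [Real.sq_sqrt hT.le]
    _ = c ^ 2 * (√T ^ p / √T ^ 5) := by field_simp
    _ = c ^ 2 * √T ^ (p - 5) := by rw [← Real.rpow_sub_natCast hR.ne', Nat.cast_ofNat]
    _ = c ^ 2 * T ^ ((p - 5) / 2) := by
        rw [Real.sqrt_eq_rpow, ← Real.rpow_mul hT.le]
        ring_nf

section SchrodingerBounds

variable {V : lp (fun _ : ℤ => ℝ) ∞} {σ : ℤ} (hV : ∀ n, Even (n + σ) → V n = 0)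
  {m : ℤ} {T : ℝ} (hT : 1 ≤ T)
include hV hT

theorem exists_unit_forall_le_laplaceEvolution (m : ℤ) :
    ∃ s : ℤˣ, ∀ k : ℕ, 1 / (2 * (‖V‖ + 2)) ≤ Real.exp (k * ((‖V‖ + 2) / √T)) *
      (√T * (‖laplaceEvolution (schrodinger V) (2 / T) (delta m) (m + s * k)‖ +
        ‖laplaceEvolution (schrodinger V) (2 / T) (delta m) (m + s * (k + 1 : ℕ))‖)) := by
  have hT0 : 0 < T := by linarith
  have hz : ‖Complex.I * ((2 / T : ℝ) : ℂ)‖ = 2 / T := by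
    rw [norm_mul, Complex.norm_I, one_mul, Complex.norm_real, Real.norm_of_nonneg (by positivity)]
  have hrec := laplaceEvolution_schrodinger_recurrence V (delta m) (ε := 2 / T) (by positivity)
  refine exists_unit_forall_le_norm_add_norm (σ := σ)
    (W := fun n => Complex.I * ((2 / T : ℝ) : ℂ) - V n) (by linarith [norm_nonneg V])
    (Real.one_le_sqrt.2 hT) (fun n => ?_) (fun n hn => ?_) (fun n hn => ?_) ?_
  · calc ‖Complex.I * ((2 / T : ℝ) : ℂ) - V n‖ ≤ 2 / T + ‖V n‖ := by
          simpa only [hz, Complex.norm_real] using norm_sub_le (Complex.I * ((2 / T : ℝ) : ℂ)) (V n)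
      _ ≤ 2 + ‖V‖ := add_le_add (div_le_self zero_le_two hT)
          (lp.norm_apply_le_norm ENNReal.top_ne_zero V n)
      _ = ‖V‖ + 2 := add_comm _ _
  · rw [hV n hn, Complex.ofReal_zero, sub_zero, hz, Real.sq_sqrt hT0.le]
    gcongr
    exact le_add_of_nonneg_left (norm_nonneg V)
  · rw [hrec n, delta_of_ne hn, mul_zero, sub_zero]
  · rw [hrec m, delta_self, sub_sub_cancel_left, mul_one, norm_neg, Complex.norm_I]

theorem exists_unit_forall_exp_neg_div_le_laplaceEvolution (m : ℤ) (a : ℝ) :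
    ∃ s : ℤˣ, ∀ k : ℕ, k ≤ a * √T → Real.exp (-(a * (‖V‖ + 2))) / (2 * (‖V‖ + 2)) / √T ≤
      ‖laplaceEvolution (schrodinger V) (2 / T) (delta m) (m + s * k)‖ +
        ‖laplaceEvolution (schrodinger V) (2 / T) (delta m) (m + s * (k + 1 : ℕ))‖ := by
  obtain ⟨s, hs⟩ := exists_unit_forall_le_laplaceEvolution hV hT m
  refine ⟨s, fun k hk => ?_⟩
  have hR : 0 < √T := Real.sqrt_pos.2 (by linarith)
  have hexp : k * ((‖V‖ + 2) / √T) ≤ a * (‖V‖ + 2) := by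
    rw [mul_div_left_comm, mul_comm a]
    gcongr
    exact (div_le_iff₀ hR).2 hk
  rw [div_le_iff₀' hR]
  calc Real.exp (-(a * (‖V‖ + 2))) / (2 * (‖V‖ + 2))
      = Real.exp (-(a * (‖V‖ + 2))) * (1 / (2 * (‖V‖ + 2))) := div_eq_mul_one_div _ _
    _ ≤ Real.exp (-(a * (‖V‖ + 2))) * (Real.exp (a * (‖V‖ + 2)) * _) := by
        gcongr
        exact (hs k).trans (by gcongr)
    _ = _ := by rw [← mul_assoc, ← Real.exp_add, neg_add_cancel, Real.exp_zero, one_mul]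

theorem ofReal_rpow_le_avgMoment_schrodinger {p : ℝ} (hp : 0 ≤ p) (hm : |(m : ℝ)| ≤ √T) :
    ENNReal.ofReal ((Real.exp (-(6 * (‖V‖ + 2))) / (2 * (‖V‖ + 2))) ^ 2 * T ^ ((p - 5) / 2)) ≤
      avgMoment (schrodinger V) (delta m) p T := by
  have hT0 : 0 < T := by linarith
  have hR1 : 1 ≤ √T := Real.one_le_sqrt.2 hT
  obtain ⟨s, hs⟩ := exists_unit_forall_exp_neg_div_le_laplaceEvolution hV hT m 6
  set c := Real.exp (-(6 * (‖V‖ + 2))) / (2 * (‖V‖ + 2))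
  set L := ⌈2 * √T⌉₊
  have hL : 2 * √T ≤ L := Nat.le_ceil _
  have hL' : L ≤ 3 * √T := by linarith [Nat.ceil_lt_add_one (by positivity : 0 ≤ 2 * √T)]
  have hfar : ∀ k ≥ L, √T ≤ |((m + s * (k : ℕ) : ℤ) : ℝ)| := fun k hk =>
    le_abs_add_unit_mul hm (hL.trans (by exact_mod_cast hk)) s
  have hmoment := ofReal_card_mul_le_avgMoment (isSelfAdjoint_schrodinger V) (delta m) hp hT0
    (Real.sqrt_nonneg T) (b := c / √T) (by positivity) (add_unit_mul_injective m s)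
    (s := Finset.Ico L (2 * L))
    (fun k hk => ⟨hfar k (Finset.mem_Ico.1 hk).1, hfar (k + 1) (by grind)⟩)
    (fun k hk => hs k <| by
      have hk2 : (k : ℝ) ≤ 2 * L := by exact_mod_cast (Finset.mem_Ico.1 hk).2.le
      linarith)
  rw [Nat.card_Ico, two_mul L, Nat.add_sub_cancel] at hmoment
  refine (ENNReal.mul_le_mul_iff_right two_ne_zero ENNReal.ofNat_ne_top).1 (le_trans ?_ hmoment)
  rw [← ENNReal.ofReal_ofNat 2, ← ENNReal.ofReal_mul zero_le_two]
  refine ENNReal.ofReal_le_ofReal ?_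
  calc 2 * (c ^ 2 * T ^ ((p - 5) / 2)) = 2 * √T * (√T ^ p * (c / √T / T) ^ 2) := by
        rw [mul_assoc, sqrt_mul_sqrt_rpow_mul_div_sq hT0]
    _ ≤ L * (√T ^ p * (c / √T / T) ^ 2) := by gcongr

end SchrodingerBounds

end QuantumDynamics

open QuantumDynamics in
theorem theorem3_general {V : lp (fun _ : ℤ => ℝ) ∞} {σ : ℤ} (hV : ∀ n, Even (n + σ) → V n = 0)
    (m : ℤ) {p : ℝ} (hp : 0 ≤ p) :
    (((p - 5) / 2 : ℝ) : EReal) ≤ betaMinus (schrodinger V) (delta m) p := by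
  have hm : ∀ᶠ T : ℝ in Filter.atTop, |(m : ℝ)| ≤ √T :=
    Real.tendsto_sqrt_atTop.eventually_ge_atTop _
  refine coe_le_liminf_log_div_log
    (c := (Real.exp (-(6 * (‖V‖ + 2))) / (2 * (‖V‖ + 2))) ^ 2) (by positivity) ?_
  filter_upwards [Filter.eventually_ge_atTop 1, hm] with T hT hmT
  exact ofReal_rpow_le_avgMoment_schrodinger hV hT hp hmT

theorem theorem3 (lam : ℝ) (ω : ℤ → Fin 2) (hω : ω ∈ PeriodDoubling.subshift)
    (p : ℝ) (hp : 0 < p) :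
    (((p - 5) / 2 : ℝ) : EReal) ≤
      QuantumDynamics.betaMinus (PeriodDoubling.hamiltonian lam ω)
        (QuantumDynamics.delta 1) p := by
  obtain ⟨σ, hσ⟩ := PeriodDoubling.exists_forall_even_potential_eq_zero lam hω
  exact theorem3_general hσ 1 hp.le
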